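/- Let $X$ be a paracompact, smooth Hausdorff manifold of dimension $n$, let $I=(0,1]$, and let $\mathcal G(X)=\mathcal E_M(X)/\mathcal N(X)$ be the special Colombeau algebra of $X$: nets $(u_\varepsilon)_{\varepsilon\in I}$ of smooth real functions all of whose derivatives, in every chart and uniformly on every compact set, are $O(\varepsilon^{-N})$ for some $N$ as $\varepsilon\to0$ (moderate nets), modulo those for which they are $O(\varepsilon^{m})$ for every $m$ (negligible nets). Let $\mathcal G^1_0(X)$ and $\mathcal G^0_2(X)$ be the spaces of generalized vector fields and of generalized $(0,2)$-tensor fields, i.e. nets of smooth tensor fields with moderate components in every chart, modulo those with negligible components; all tensor operations are defined on representatives. An element $f\in\mathcal G(X)$ is strictly positive, $f>0$, if it is invertible in $\mathcal G(X)$ and for each compact $K\subset X$ has a representative that is non-negative on $K$; $f<0$ means $-f>0$. A generalized pseudo-Riemannian metric of index $j$ is a $g\in\mathcal G^0_2(X)$ such that (a) for each chart $(V_\alpha,\psi_\alpha)$ the determinant $\det g_\alpha$ of the matrix of components of $g$ is invertible in $\mathcal G(\psi_\alpha(V_\alpha))$, and (b) for each relatively compact open $V\subset X$ there are a representative $(g_\varepsilon)_\varepsilon$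 of $g$ and an $\varepsilon_0>0$ such that for all $\varepsilon<\varepsilon_0$ the restriction $g_\varepsilon|_V$ is a smooth pseudo-Riemannian metric (symmetric and non-degenerate) of index $j$. Generalized Riemannian metrics are those of index $0$, generalized Lorentzian metrics those of index $1$. **Theorem.** Let $g$ be a generalized Lorentzian metric on $X$, write $\langle\xi,\eta\rangle=g(\xi,\eta)=g_{ab}\xi^a\eta^b\in\mathcal G(X)$, and let $\xi,\eta\in\mathcal G^1_0(X)$ be time-like, i.e. $\langle\xi,\xi\rangle<0$ and $\langle\eta,\eta\rangle<0$ in $\mathcal G(X)$, with the same time orientation, i.e. $\langle\xi,\eta\rangle<0$ in $\mathcal G(X)$. Then $$h_{ab}:=\xi_{(a}\eta_{b)}-\tfrac12\langle\xi,\eta\rangle\,g_{ab}\ \in\ \mathcal G^0_2(X)$$ is a generalized Riemannian metric, where $\xi_a=g_{ab}\xi^b$, $\eta_a=g_{ab}\eta^b$ and $\xi_{(a}\eta_{b)}=\tfrac12(\xi_a\eta_b+\xi_b\eta_a)$. -/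

import Mathlib

open Set Filter Topology
open scoped Manifold ContDiff Bundle

namespace Colombeau

/-- The index set `I = (0, 1]` of all nets. -/
abbrev Idx : Type := Set.Ioc (0 : ℝ) 1

/-- The filter `ε → 0` on the index set. -/
def toZero : Filter Idx := comap (fun ε : Idx => (ε : ℝ)) (𝓝 0)

/-- The model space `ℝⁿ`. -/
abbrev Euc (n : ℕ) : Type := EuclideanSpace ℝ (Fin n)

/-! ### The algebra of generalized functions on an open subset of `ℝⁿ` -/

section Local

variable {n : ℕ} (Ω : TopologicalSpace.Opens (Euc n))

/-- `sup_{x ∈ K} ‖D^k u_ε (x)‖ = O(ε ^ m)` as `ε → 0`. -/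
def HasGrowth (K : Set (Euc n)) (k : ℕ) (u : Idx → Euc n → ℝ) (m : ℤ) : Prop :=
  ∃ C : ℝ, ∀ᶠ ε in toZero, ∀ x ∈ K,
    ‖iteratedFDerivWithin ℝ k (u ε) (Ω : Set (Euc n)) x‖ ≤ C * (ε : ℝ) ^ m

/-- Moderate nets of smooth functions on `Ω`; only the values on `Ω` matter. -/
def IsModerate (u : Idx → Euc n → ℝ) : Prop :=
  (∀ ε, ContDiffOn ℝ ∞ (u ε) (Ω : Set (Euc n))) ∧
    ∀ K : Set (Euc n), K ⊆ Ω → IsCompact K → ∀ k : ℕ, ∃ N : ℕ, HasGrowth Ω K k u (-(N : ℤ))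

/-- Negligible nets of smooth functions on `Ω`; only the values on `Ω` matter. -/
def IsNegligible (u : Idx → Euc n → ℝ) : Prop :=
  (∀ ε, ContDiffOn ℝ ∞ (u ε) (Ω : Set (Euc n))) ∧
    ∀ K : Set (Euc n), K ⊆ Ω → IsCompact K → ∀ k m : ℕ, HasGrowth Ω K k u (m : ℤ)

variable {Ω} {K : Set (Euc n)} {k : ℕ} {u v : Idx → Euc n → ℝ}

lemma HasGrowth.mono {a b : ℤ} (h : HasGrowth Ω K k u b) (hab : a ≤ b) :
    HasGrowth Ω K k u a := by
  obtain ⟨C, hC⟩ := h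
  refine ⟨|C|, hC.mono fun ε hε x hx => (hε x hx).trans ?_⟩
  have h0 : (0 : ℝ) < (ε : ℝ) := ε.2.1
  calc C * (ε : ℝ) ^ b ≤ |C| * (ε : ℝ) ^ b := by
        gcongr
        exact le_abs_self C
    _ ≤ |C| * (ε : ℝ) ^ a := by
        exact mul_le_mul_of_nonneg_left (zpow_le_zpow_right_of_le_one₀ h0 ε.2.2 hab) (abs_nonneg C)

lemma HasGrowth.congr {a : ℤ} (h : HasGrowth Ω K k u a) (hK : K ⊆ Ω)
    (huv : ∀ ε, EqOn (v ε) (u ε) Ω) : HasGrowth Ω K k v a := by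
  obtain ⟨C, hC⟩ := h
  refine ⟨C, hC.mono fun ε hε x hx => ?_⟩
  rw [iteratedFDerivWithin_congr (huv ε) (hK hx)]
  exact hε x hx

lemma HasGrowth.add {a : ℤ} (hK : K ⊆ Ω)
    (hu : ∀ ε, ContDiffOn ℝ ∞ (u ε) (Ω : Set (Euc n)))
    (hv : ∀ ε, ContDiffOn ℝ ∞ (v ε) (Ω : Set (Euc n)))
    (h : HasGrowth Ω K k u a) (h' : HasGrowth Ω K k v a) : HasGrowth Ω K k (u + v) a := by
  obtain ⟨C, hC⟩ := h
  obtain ⟨C', hC'⟩ := h'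
  refine ⟨C + C', ?_⟩
  filter_upwards [hC, hC'] with ε h1 h2 x hx
  have hk : (k : WithTop ℕ∞) ≤ ∞ := by exact_mod_cast le_top
  have e : iteratedFDerivWithin ℝ k ((u + v) ε) (Ω : Set (Euc n)) x =
      iteratedFDerivWithin ℝ k (u ε) (Ω : Set (Euc n)) x +
        iteratedFDerivWithin ℝ k (v ε) (Ω : Set (Euc n)) x :=
    iteratedFDerivWithin_add_apply (((hu ε).of_le hk) x (hK hx)) (((hv ε).of_le hk) x (hK hx))
      Ω.isOpen.uniqueDiffOn (hK hx)
  rw [e, add_mul]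
  exact (norm_add_le _ _).trans (add_le_add (h1 x hx) (h2 x hx))

lemma HasGrowth.mul {a b : ℤ} (hK : K ⊆ Ω)
    (hu : ∀ ε, ContDiffOn ℝ ∞ (u ε) (Ω : Set (Euc n)))
    (hv : ∀ ε, ContDiffOn ℝ ∞ (v ε) (Ω : Set (Euc n)))
    (h : ∀ i ≤ k, HasGrowth Ω K i u a) (h' : ∀ i ≤ k, HasGrowth Ω K i v b) :
    HasGrowth Ω K k (u * v) (a + b) := by
  choose! C hC using h
  choose! C' hC' using h'
  refine ⟨∑ i ∈ Finset.range (k + 1), (k.choose i : ℝ) * C i * C' (k - i), ?_⟩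
  have H : ∀ᶠ ε in toZero, ∀ i ∈ Finset.range (k + 1), (∀ x ∈ K,
      ‖iteratedFDerivWithin ℝ i (u ε) (Ω : Set (Euc n)) x‖ ≤ C i * (ε : ℝ) ^ a) ∧
      ∀ x ∈ K, ‖iteratedFDerivWithin ℝ (k - i) (v ε) (Ω : Set (Euc n)) x‖
        ≤ C' (k - i) * (ε : ℝ) ^ b := by
    rw [eventually_all_finset]
    intro i hi
    exact (hC i (by simpa [Nat.lt_succ_iff] using hi)).and (hC' (k - i) (Nat.sub_le _ _))
  filter_upwards [H] with ε hε x hx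
  have hk : (k : WithTop ℕ∞) ≤ ∞ := by exact_mod_cast le_top
  have h0 : (ε : ℝ) ≠ 0 := ε.2.1.ne'
  refine (norm_iteratedFDerivWithin_mul_le (hu ε) (hv ε) Ω.isOpen.uniqueDiffOn (hK hx) hk).trans ?_
  rw [Finset.sum_mul]
  refine Finset.sum_le_sum fun i hi => ?_
  have h1 := (hε i hi).1 x hx
  have h2 := (hε i hi).2 x hx
  calc (k.choose i : ℝ) * ‖iteratedFDerivWithin ℝ i (u ε) (Ω : Set (Euc n)) x‖ *
        ‖iteratedFDerivWithin ℝ (k - i) (v ε) (Ω : Set (Euc n)) x‖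
      ≤ (k.choose i : ℝ) * (C i * (ε : ℝ) ^ a) * (C' (k - i) * (ε : ℝ) ^ b) := by
        have := (norm_nonneg _).trans h1
        gcongr
    _ = (k.choose i : ℝ) * C i * C' (k - i) * (ε : ℝ) ^ (a + b) := by
        rw [zpow_add₀ h0]; ring

lemma IsModerate.unif (hu : IsModerate Ω u) (hK : K ⊆ Ω) (hc : IsCompact K) (k : ℕ) :
    ∃ N : ℕ, ∀ i ≤ k, HasGrowth Ω K i u (-(N : ℤ)) := by
  choose N hN using hu.2 K hK hc
  refine ⟨(Finset.range (k + 1)).sup N, fun i hi => (hN i).mono ?_⟩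
  have : N i ≤ (Finset.range (k + 1)).sup N :=
    Finset.le_sup (f := N) (by simpa [Nat.lt_succ_iff] using hi)
  omega

lemma IsModerate.add (hu : IsModerate Ω u) (hv : IsModerate Ω v) : IsModerate Ω (u + v) := by
  refine ⟨fun ε => (hu.1 ε).add (hv.1 ε), fun K hK hc k => ?_⟩
  obtain ⟨N, hN⟩ := hu.2 K hK hc k
  obtain ⟨M, hM⟩ := hv.2 K hK hc k
  exact ⟨max N M, HasGrowth.add hK hu.1 hv.1 (hN.mono (by simp)) (hM.mono (by simp))⟩

lemma IsModerate.mul (hu : IsModerate Ω u) (hv : IsModerate Ω v) : IsModerate Ω (u * v) := by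
  refine ⟨fun ε => (hu.1 ε).mul (hv.1 ε), fun K hK hc k => ?_⟩
  obtain ⟨N, hN⟩ := hu.unif hK hc k
  obtain ⟨M, hM⟩ := hv.unif hK hc k
  exact ⟨N + M, (HasGrowth.mul hK hu.1 hv.1 hN hM).mono (by push_cast; omega)⟩

lemma isModerate_const (c : ℝ) : IsModerate Ω (fun _ _ => c) := by
  refine ⟨fun ε => contDiffOn_const, fun K hK hc k => ⟨0, |c|, .of_forall fun ε x hx => ?_⟩⟩
  rcases Nat.eq_zero_or_pos k with rfl | hk
  · simp
  · rw [iteratedFDerivWithin_const_of_ne hk.ne']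
    simp

lemma IsModerate.congr (hu : IsModerate Ω u) (h : ∀ ε, EqOn (v ε) (u ε) Ω) : IsModerate Ω v :=
  ⟨fun ε => (hu.1 ε).congr (h ε), fun K hK hc k =>
    (hu.2 K hK hc k).imp fun _ hN => hN.congr hK h⟩

lemma IsNegligible.congr (hu : IsNegligible Ω u) (h : ∀ ε, EqOn (v ε) (u ε) Ω) :
    IsNegligible Ω v :=
  ⟨fun ε => (hu.1 ε).congr (h ε), fun K hK hc k m => (hu.2 K hK hc k m).congr hK h⟩

lemma IsNegligible.isModerate (hu : IsNegligible Ω u) : IsModerate Ω u :=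
  ⟨hu.1, fun K hK hc k => ⟨0, (hu.2 K hK hc k 0).mono (by simp)⟩⟩

lemma IsNegligible.add (hu : IsNegligible Ω u) (hv : IsNegligible Ω v) :
    IsNegligible Ω (u + v) :=
  ⟨fun ε => (hu.1 ε).add (hv.1 ε), fun K hK hc k m =>
    HasGrowth.add hK hu.1 hv.1 (hu.2 K hK hc k m) (hv.2 K hK hc k m)⟩

lemma IsModerate.mul_negligible (hu : IsModerate Ω u) (hv : IsNegligible Ω v) :
    IsNegligible Ω (u * v) := by
  refine ⟨fun ε => (hu.1 ε).mul (hv.1 ε), fun K hK hc k m => ?_⟩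
  obtain ⟨N, hN⟩ := hu.unif hK hc k
  exact (HasGrowth.mul hK hu.1 hv.1 hN (fun i _ => hv.2 K hK hc i (N + m))).mono
    (by push_cast; omega)

lemma IsNegligible.mul_moderate (hu : IsNegligible Ω u) (hv : IsModerate Ω v) :
    IsNegligible Ω (u * v) := by
  rw [mul_comm]
  exact hv.mul_negligible hu

lemma isNegligible_zero : IsNegligible Ω (0 : Idx → Euc n → ℝ) := by
  refine ⟨fun ε => contDiffOn_const, fun K hK hc k m => ⟨0, .of_forall fun ε x hx => ?_⟩⟩
  have : ((0 : Idx → Euc n → ℝ) ε) = fun _ => 0 := rfl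
  rw [this, iteratedFDerivWithin_fun_zero]
  simp

variable (Ω)

/-- The algebra `ℰ_M(Ω)` of moderate nets. -/
def moderateNets : Subalgebra ℝ (Idx → Euc n → ℝ) where
  carrier := {u | IsModerate Ω u}
  mul_mem' := IsModerate.mul
  add_mem' := IsModerate.add
  algebraMap_mem' c := isModerate_const c

/-- The ideal `𝒩(Ω)` of negligible nets in `ℰ_M(Ω)`. -/
def negligibleNets : Ideal (moderateNets Ω) where
  carrier := {u | IsNegligible Ω (u : Idx → Euc n → ℝ)}
  add_mem' := IsNegligible.add
  zero_mem' := isNegligible_zero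
  smul_mem' c _ hu := IsModerate.mul_negligible c.2 hu

/-- The special Colombeau algebra `𝒢(Ω) = ℰ_M(Ω) / 𝒩(Ω)` of an open set `Ω ⊆ ℝⁿ`. -/
abbrev GenFunOn : Type := moderateNets Ω ⧸ negligibleNets Ω

end Local
/-! ### Smooth functions and tensor fields on a manifold, and their local expressions -/

noncomputable section Smooth

variable (n : ℕ) (X : Type*) [TopologicalSpace X] [ChartedSpace (Euc n) X]

/-- The charts of the smooth manifold `X` (all charts of the maximal smooth atlas). -/
abbrev Chart : Type _ :=
  {e : OpenPartialHomeomorph X (Euc n) // e ∈ IsManifold.maximalAtlas (𝓡 n) ∞ X}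

variable {n X}

/-- The open image `ψ(V) ⊆ ℝⁿ` of a chart `(V, ψ)`. -/
def Chart.image (e : Chart n X) : TopologicalSpace.Opens (Euc n) := ⟨e.1.target, e.1.open_target⟩

/-- The coordinate vector `∂_i` of the chart `e` at the point with coordinates `y`. -/
def Chart.coordVec (e : Chart n X) (i : Fin n) (y : Euc n) :
    TangentSpace (𝓡 n) (e.1.symm y) :=
  mfderiv (𝓡 n) (𝓡 n) e.1.symm y (EuclideanSpace.single i (1 : ℝ) : Euc n)

/-- The `i`-th coordinate in the chart `e` of a tangent vector at the point with coordinates `y`. -/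
def Chart.vecCoord (e : Chart n X) (i : Fin n) (y : Euc n) :
    TangentSpace (𝓡 n) (e.1.symm y) →ₗ[ℝ] ℝ where
  toFun v := (show Euc n from mfderiv (𝓡 n) (𝓡 n) e.1 (e.1.symm y) v) i
  map_add' v w := by rw [map_add]; rfl
  map_smul' c v := by rw [map_smul]; rfl

/-- A tangent vector is the sum of its coordinates times the coordinate vectors. -/
lemma Chart.sum_vecCoord (e : Chart n X) {y : Euc n} (hy : y ∈ e.1.target)
    (v : TangentSpace (𝓡 n) (e.1.symm y)) :
    ∑ i, e.vecCoord i y v • e.coordVec i y = v := by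
  have hd : e.1.MDifferentiable (𝓡 n) (𝓡 n) :=
    ⟨(contMDiffOn_of_mem_maximalAtlas e.2).mdifferentiableOn (by simp),
      (contMDiffOn_symm_of_mem_maximalAtlas e.2).mdifferentiableOn (by simp)⟩
  have h := hd.symm_comp_deriv (e.1.map_target hy)
  rw [e.1.right_inv hy] at h
  have h2 := DFunLike.congr_fun h v
  conv_rhs => rw [← show _ = v from h2]
  set w : Euc n := mfderiv (𝓡 n) (𝓡 n) e.1 (e.1.symm y) v with hw
  change ∑ i, w i • mfderiv (𝓡 n) (𝓡 n) e.1.symm y (EuclideanSpace.single i (1 : ℝ) : Euc n) =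
    mfderiv (𝓡 n) (𝓡 n) e.1.symm y w
  have hsum : w = ∑ i, w i • (EuclideanSpace.single i (1 : ℝ) : Euc n) := by
    ext j
    simp [Pi.single_apply]
  conv_rhs => rw [hsum]
  let L : Euc n →ₗ[ℝ] TangentSpace (𝓡 n) (e.1.symm y) :=
    (mfderiv (𝓡 n) (𝓡 n) e.1.symm y).toLinearMap
  change ∑ i, w i • L (EuclideanSpace.single i (1 : ℝ)) = L _
  rw [map_sum]
  simp_rw [map_smul]

variable (n X) [IsManifold (𝓡 n) ∞ X]

/-- Smooth real functions on `X`. -/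
abbrev SmoothFun : Type _ := ContMDiffMap (𝓡 n) 𝓘(ℝ, ℝ) X ℝ ∞

/-- Smooth vector fields on `X`, i.e. tensor fields of type `(1, 0)`. -/
abbrev VecField : Type _ :=
  ContMDiffSection (𝓡 n) (Euc n) ∞ (fun x : X => TangentSpace (𝓡 n) x)

/-- Smooth one-forms on `X`, i.e. tensor fields of type `(0, 1)`. -/
abbrev OneForm : Type _ :=
  ContMDiffSection (𝓡 n) (Euc n →L[ℝ] ℝ) ∞ (fun x : X => TangentSpace (𝓡 n) x →L[ℝ] ℝ)

/-- Smooth tensor fields of type `(0, 2)` on `X`. -/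
abbrev Tensor02 : Type _ :=
  ContMDiffSection (𝓡 n) (Euc n →L[ℝ] Euc n →L[ℝ] ℝ) ∞
    (fun x : X => TangentSpace (𝓡 n) x →L[ℝ] TangentSpace (𝓡 n) x →L[ℝ] ℝ)

variable {n X}

set_option synthInstance.maxHeartbeats 400000 in
instance (x : X) : IsTopologicalAddGroup (TangentSpace (𝓡 n) x →L[ℝ] ℝ) := inferInstance

instance (x : X) : ContinuousAdd (TangentSpace (𝓡 n) x →L[ℝ] ℝ) :=
  IsTopologicalAddGroup.toContinuousAdd

set_option synthInstance.maxHeartbeats 400000 in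
instance (x : X) : ContinuousSMul ℝ (TangentSpace (𝓡 n) x →L[ℝ] ℝ) := inferInstance

instance (x : X) :
    AddCommGroup (TangentSpace (𝓡 n) x →L[ℝ] TangentSpace (𝓡 n) x →L[ℝ] ℝ) :=
  ContinuousLinearMap.addCommGroup

instance (x : X) : AddCommMonoid (TangentSpace (𝓡 n) x →L[ℝ] TangentSpace (𝓡 n) x →L[ℝ] ℝ) :=
  ContinuousLinearMap.addCommMonoid

set_option synthInstance.maxHeartbeats 400000 in
instance (x : X) :
    Module ℝ (TangentSpace (𝓡 n) x →L[ℝ] TangentSpace (𝓡 n) x →L[ℝ] ℝ) := inferInstance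

instance : AddCommGroup (OneForm n X) := inferInstance

instance : Module ℝ (OneForm n X) := inferInstance

instance : AddCommGroup (Tensor02 n X) := inferInstance

instance : Module ℝ (Tensor02 n X) := inferInstance

/-- The local expression `f ∘ ψ⁻¹` of a function. -/
def funComp (e : Chart n X) : SmoothFun n X →ₗ[ℝ] (Euc n → ℝ) where
  toFun f y := f (e.1.symm y)
  map_add' _ _ := rfl
  map_smul' _ _ := rfl

/-- The components `ξ^i` of a vector field in a chart. -/
def vecComp (e : Chart n X) (i : Fin n) : VecField n X →ₗ[ℝ] (Euc n → ℝ) where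
  toFun ξ y := e.vecCoord i y (ξ (e.1.symm y))
  map_add' ξ η := by ext y; exact map_add (e.vecCoord i y) _ _
  map_smul' c ξ := by ext y; exact map_smul (e.vecCoord i y) _ _

/-- The components `θ_i` of a one-form in a chart. -/
def formComp (e : Chart n X) (i : Fin n) : OneForm n X →ₗ[ℝ] (Euc n → ℝ) where
  toFun θ y := θ (e.1.symm y) (e.coordVec i y)
  map_add' _ _ := rfl
  map_smul' _ _ := rfl

/-- The components `g_{ij}` of a `(0, 2)`-tensor field in a chart. -/
def tensorComp (e : Chart n X) (ij : Fin n × Fin n) :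
    Tensor02 n X →ₗ[ℝ] (Euc n → ℝ) where
  toFun g y := g (e.1.symm y) (e.coordVec ij.1 y) (e.coordVec ij.2 y)
  map_add' _ _ := rfl
  map_smul' _ _ := rfl

/-- Lowering an index: the one-form `g(ξ, ·)`. -/
def smoothFlat (g : Tensor02 n X) (ξ : VecField n X) : OneForm n X :=
  ⟨fun x => g x (ξ x), g.contMDiff.clm_bundle_apply ξ.contMDiff⟩

/-- The contraction `θ(η)` of a one-form with a vector field. -/
def smoothPair (θ : OneForm n X) (η : VecField n X) : SmoothFun n X :=
  ⟨fun x => θ x (η x), by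
    have h := ContMDiff.clm_bundle_apply (E₂ := fun _ : X => ℝ) θ.contMDiff η.contMDiff
    exact fun x => (Bundle.contMDiffAt_totalSpace.1 (h x)).2⟩

/-- The product `f g` of a function and a `(0, 2)`-tensor field. -/
def smoothSmul (f : SmoothFun n X) (g : Tensor02 n X) : Tensor02 n X :=
  ⟨fun x => f x • g x, f.contMDiff.smul_section g.contMDiff⟩

lemma contMDiffAt_smulRight_aux {V H M : Type*} [NormedAddCommGroup V] [NormedSpace ℝ V]
    [TopologicalSpace H] {J : ModelWithCorners ℝ V H} [TopologicalSpace M] [ChartedSpace H M]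
    {a b : M → V →L[ℝ] ℝ} {x : M} (ha : ContMDiffAt J 𝓘(ℝ, V →L[ℝ] ℝ) ∞ a x)
    (hb : ContMDiffAt J 𝓘(ℝ, V →L[ℝ] ℝ) ∞ b x) :
    ContMDiffAt J 𝓘(ℝ, V →L[ℝ] V →L[ℝ] ℝ) ∞ (fun y => (a y).smulRight (b y)) x := by
  have h : ContDiff ℝ ∞ (fun p : (V →L[ℝ] ℝ) × (V →L[ℝ] ℝ) => p.1.smulRight p.2) :=
    contDiff_fst.smulRight contDiff_snd
  exact h.contMDiff.contMDiffAt.comp x (ha.prodMk_space hb)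

lemma contMDiff_smulRight (φ ψ : OneForm n X) :
    ContMDiff (𝓡 n) ((𝓡 n).prod 𝓘(ℝ, Euc n →L[ℝ] Euc n →L[ℝ] ℝ)) ∞
      (fun x : X => Bundle.TotalSpace.mk' (Euc n →L[ℝ] Euc n →L[ℝ] ℝ)
        (E := fun x : X => TangentSpace (𝓡 n) x →L[ℝ] TangentSpace (𝓡 n) x →L[ℝ] ℝ) x
        ((φ x).smulRight (ψ x))) := by
  intro x₀
  have h1 := φ.contMDiff x₀
  have h2 := ψ.contMDiff x₀
  rw [contMDiffAt_hom_bundle] at h1 h2 ⊢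
  refine ⟨contMDiffAt_id, ?_⟩
  have h3 := contMDiffAt_smulRight_aux h1.2 h2.2
  refine h3.congr_of_eventuallyEq ?_
  filter_upwards [(chartAt (Euc n) x₀).open_source.mem_nhds (mem_chart_source (Euc n) x₀)]
    with x hx
  ext v w
  simp [ContinuousLinearMap.inCoordinates, Bundle.Trivialization.linearMapAt_apply,
    hom_trivializationAt_apply, hx]

/-- The symmetrised product `φ_(a ψ_b) = (φ_a ψ_b + φ_b ψ_a) / 2` of two one-forms. -/
def smoothSymProd (φ ψ : OneForm n X) : Tensor02 n X :=
  (1 / 2 : ℝ) • ((⟨fun x => (φ x).smulRight (ψ x), contMDiff_smulRight φ ψ⟩ : Tensor02 n X) +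
    ⟨fun x => (ψ x).smulRight (φ x), contMDiff_smulRight ψ φ⟩)

end Smooth
/-! ### Generalized functions and generalized tensor fields -/

noncomputable section Generalized

variable {n : ℕ} {X : Type*} [TopologicalSpace X] [ChartedSpace (Euc n) X]
  [IsManifold (𝓡 n) ∞ X]

section Nets

variable {S κ : Type*} [AddCommGroup S] [Module ℝ S]

/-- Nets of smooth objects all of whose components in all charts are moderate. -/
def moderateSub (comp : Chart n X → κ → S →ₗ[ℝ] (Euc n → ℝ)) : Submodule ℝ (Idx → S) where
  carrier := {u | ∀ (e : Chart n X) (k : κ), IsModerate e.image fun ε => comp e k (u ε)}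
  add_mem' {u v} hu hv e k := by
    simp only [Pi.add_apply, map_add]
    exact (hu e k).add (hv e k)
  zero_mem' e k := by
    simp only [Pi.zero_apply, map_zero]
    exact (isNegligible_zero (Ω := e.image)).isModerate
  smul_mem' c u hu e k := by
    simp only [Pi.smul_apply, map_smul]
    exact (isModerate_const c).mul (hu e k)

/-- Nets of smooth objects all of whose components in all charts are negligible. -/
def negligibleSub (comp : Chart n X → κ → S →ₗ[ℝ] (Euc n → ℝ)) : Submodule ℝ (Idx → S) where
  carrier := {u | ∀ (e : Chart n X) (k : κ), IsNegligible e.image fun ε => comp e k (u ε)}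
  add_mem' {u v} hu hv e k := by
    simp only [Pi.add_apply, map_add]
    exact (hu e k).add (hv e k)
  zero_mem' e k := by
    simp only [Pi.zero_apply, map_zero]
    exact isNegligible_zero (Ω := e.image)
  smul_mem' c u hu e k := by
    simp only [Pi.smul_apply, map_smul]
    exact (isModerate_const c).mul_negligible (hu e k)

end Nets

variable (n X)

/-- The algebra `ℰ_M(X)` of moderate nets of smooth functions on `X`. -/
def moderateFun : Subalgebra ℝ (Idx → SmoothFun n X) where
  carrier := {u | ∀ e : Chart n X, IsModerate e.image fun ε => funComp e (u ε)}
  mul_mem' hu hv e := (hu e).mul (hv e)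
  add_mem' hu hv e := (hu e).add (hv e)
  algebraMap_mem' c _ := isModerate_const c

/-- The ideal `𝒩(X)` of negligible nets. -/
def negligibleFun : Ideal (moderateFun n X) where
  carrier := {u | ∀ e : Chart n X, IsNegligible e.image fun ε => funComp e (u.1 ε)}
  add_mem' hu hv e := (hu e).add (hv e)
  zero_mem' _ := isNegligible_zero
  smul_mem' c _ hu e := (c.2 e).mul_negligible (hu e)

/-- The special Colombeau algebra `𝒢(X) = ℰ_M(X) / 𝒩(X)`. -/
abbrev GenFun : Type _ := moderateFun n X ⧸ negligibleFun n X

/-- Moderate nets of vector fields. -/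
def moderateVec : Submodule ℝ (Idx → VecField n X) := moderateSub vecComp

/-- Negligible nets of vector fields. -/
def negligibleVec : Submodule ℝ (Idx → VecField n X) := negligibleSub vecComp

/-- Generalized vector fields `𝒢¹₀(X)`. -/
abbrev GenVecField : Type _ := moderateVec n X ⧸ (negligibleVec n X).submoduleOf (moderateVec n X)

/-- Moderate nets of one-forms. -/
def moderateForm : Submodule ℝ (Idx → OneForm n X) := moderateSub formComp

/-- Negligible nets of one-forms. -/
def negligibleForm : Submodule ℝ (Idx → OneForm n X) := negligibleSub formComp

/-- Generalized one-forms `𝒢⁰₁(X)`. -/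
abbrev GenOneForm : Type _ :=
  moderateForm n X ⧸ (negligibleForm n X).submoduleOf (moderateForm n X)

/-- Moderate nets of `(0, 2)`-tensor fields. -/
def moderateTensor : Submodule ℝ (Idx → Tensor02 n X) := moderateSub tensorComp

/-- Negligible nets of `(0, 2)`-tensor fields. -/
def negligibleTensor : Submodule ℝ (Idx → Tensor02 n X) := negligibleSub tensorComp

/-- Generalized tensor fields `𝒢⁰₂(X)` of type `(0, 2)`. -/
abbrev GenTensor02 : Type _ :=
  moderateTensor n X ⧸ (negligibleTensor n X).submoduleOf (moderateTensor n X)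

variable {n X}

/-! #### Componentwise formulas for the smooth operations -/

lemma formComp_flat (e : Chart n X) (j : Fin n) (g : Tensor02 n X) (ξ : VecField n X) :
    EqOn (formComp e j (smoothFlat g ξ))
      (∑ i, vecComp e i ξ * tensorComp e (i, j) g) e.image := by
  intro y hy
  change g (e.1.symm y) (ξ (e.1.symm y)) (e.coordVec j y) = _
  conv_lhs => rw [← e.sum_vecCoord hy (ξ (e.1.symm y))]
  rw [map_sum, _root_.sum_apply, Finset.sum_apply]
  refine Finset.sum_congr rfl fun i _ => ?_
  rw [map_smul]
  rfl

lemma funComp_pair (e : Chart n X) (θ : OneForm n X) (η : VecField n X) :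
    EqOn (funComp e (smoothPair θ η)) (∑ i, vecComp e i η * formComp e i θ) e.image := by
  intro y hy
  change θ (e.1.symm y) (η (e.1.symm y)) = _
  conv_lhs => rw [← e.sum_vecCoord hy (η (e.1.symm y))]
  rw [map_sum, Finset.sum_apply]
  refine Finset.sum_congr rfl fun i _ => ?_
  rw [map_smul]
  rfl

lemma tensorComp_smul (e : Chart n X) (ij : Fin n × Fin n) (f : SmoothFun n X)
    (g : Tensor02 n X) : tensorComp e ij (smoothSmul f g) = funComp e f * tensorComp e ij g := rfl

lemma tensorComp_symProd (e : Chart n X) (ij : Fin n × Fin n) (φ ψ : OneForm n X) :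
    tensorComp e ij (smoothSymProd φ ψ) = (fun _ => 1 / 2) *
      (formComp e ij.1 φ * formComp e ij.2 ψ + formComp e ij.1 ψ * formComp e ij.2 φ) := rfl

lemma isModerate_sum {Ω : TopologicalSpace.Opens (Euc n)} {ι : Type*} (s : Finset ι)
    (u : ι → Idx → Euc n → ℝ) (h : ∀ i, IsModerate Ω (u i)) : IsModerate Ω (∑ i ∈ s, u i) :=
  (moderateNets Ω).sum_mem fun i _ => h i

lemma isNegligible_sum {Ω : TopologicalSpace.Opens (Euc n)} {ι : Type*} (s : Finset ι)
    (u : ι → Idx → Euc n → ℝ) (h : ∀ i, IsNegligible Ω (u i)) : IsNegligible Ω (∑ i ∈ s, u i) := by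
  classical
  induction s using Finset.induction_on with
  | empty => simpa using isNegligible_zero
  | insert i s hi ih => rw [Finset.sum_insert hi]; exact (h i).add ih

section NetLemmas

variable {f : Idx → SmoothFun n X} {ξ : Idx → VecField n X} {θ φ ψ : Idx → OneForm n X}
  {g : Idx → Tensor02 n X}

lemma flat_moderate (hg : g ∈ moderateTensor n X) (hξ : ξ ∈ moderateVec n X) :
    (fun ε => smoothFlat (g ε) (ξ ε)) ∈ moderateForm n X := fun e j =>
  (isModerate_sum Finset.univ (fun i ε => vecComp e i (ξ ε) * tensorComp e (i, j) (g ε))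
    fun i => (hξ e i).mul (hg e (i, j))).congr fun ε y hy => by
      simpa using formComp_flat e j (g ε) (ξ ε) hy

lemma flat_negligible_left (hg : g ∈ negligibleTensor n X) (hξ : ξ ∈ moderateVec n X) :
    (fun ε => smoothFlat (g ε) (ξ ε)) ∈ negligibleForm n X := fun e j =>
  (isNegligible_sum Finset.univ (fun i ε => vecComp e i (ξ ε) * tensorComp e (i, j) (g ε))
    fun i => (hξ e i).mul_negligible (hg e (i, j))).congr fun ε y hy => by
      simpa using formComp_flat e j (g ε) (ξ ε) hy

lemma flat_negligible_right (hg : g ∈ moderateTensor n X) (hξ : ξ ∈ negligibleVec n X) :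
    (fun ε => smoothFlat (g ε) (ξ ε)) ∈ negligibleForm n X := fun e j =>
  (isNegligible_sum Finset.univ (fun i ε => vecComp e i (ξ ε) * tensorComp e (i, j) (g ε))
    fun i => (hξ e i).mul_moderate (hg e (i, j))).congr fun ε y hy => by
      simpa using formComp_flat e j (g ε) (ξ ε) hy

lemma pair_moderate (hθ : θ ∈ moderateForm n X) (hξ : ξ ∈ moderateVec n X) :
    (fun ε => smoothPair (θ ε) (ξ ε)) ∈ moderateFun n X := fun e =>
  (isModerate_sum Finset.univ (fun i ε => vecComp e i (ξ ε) * formComp e i (θ ε))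
    fun i => (hξ e i).mul (hθ e i)).congr fun ε y hy => by
      simpa using funComp_pair e (θ ε) (ξ ε) hy

lemma pair_negligible_left (hθ : θ ∈ negligibleForm n X) (hξ : ξ ∈ moderateVec n X)
    (e : Chart n X) : IsNegligible e.image fun ε => funComp e (smoothPair (θ ε) (ξ ε)) :=
  (isNegligible_sum Finset.univ (fun i ε => vecComp e i (ξ ε) * formComp e i (θ ε))
    fun i => (hξ e i).mul_negligible (hθ e i)).congr fun ε y hy => by
      simpa using funComp_pair e (θ ε) (ξ ε) hy

lemma pair_negligible_right (hθ : θ ∈ moderateForm n X) (hξ : ξ ∈ negligibleVec n X)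
    (e : Chart n X) : IsNegligible e.image fun ε => funComp e (smoothPair (θ ε) (ξ ε)) :=
  (isNegligible_sum Finset.univ (fun i ε => vecComp e i (ξ ε) * formComp e i (θ ε))
    fun i => (hξ e i).mul_moderate (hθ e i)).congr fun ε y hy => by
      simpa using funComp_pair e (θ ε) (ξ ε) hy

lemma symProd_moderate (hφ : φ ∈ moderateForm n X) (hψ : ψ ∈ moderateForm n X) :
    (fun ε => smoothSymProd (φ ε) (ψ ε)) ∈ moderateTensor n X := fun e ij =>
  (isModerate_const (1 / 2)).mul
    (((hφ e ij.1).mul (hψ e ij.2)).add ((hψ e ij.1).mul (hφ e ij.2)))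

lemma symProd_negligible_left (hφ : φ ∈ negligibleForm n X) (hψ : ψ ∈ moderateForm n X) :
    (fun ε => smoothSymProd (φ ε) (ψ ε)) ∈ negligibleTensor n X := fun e ij =>
  (isModerate_const (1 / 2)).mul_negligible
    (((hφ e ij.1).mul_moderate (hψ e ij.2)).add ((hψ e ij.1).mul_negligible (hφ e ij.2)))

lemma symProd_negligible_right (hφ : φ ∈ moderateForm n X) (hψ : ψ ∈ negligibleForm n X) :
    (fun ε => smoothSymProd (φ ε) (ψ ε)) ∈ negligibleTensor n X := fun e ij =>
  (isModerate_const (1 / 2)).mul_negligible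
    (((hφ e ij.1).mul_negligible (hψ e ij.2)).add ((hψ e ij.1).mul_moderate (hφ e ij.2)))

lemma smul_moderate (hf : f ∈ moderateFun n X) (hg : g ∈ moderateTensor n X) :
    (fun ε => smoothSmul (f ε) (g ε)) ∈ moderateTensor n X := fun e ij =>
  (hf e).mul (hg e ij)

lemma smul_negligible_left (hf : ∀ e : Chart n X, IsNegligible e.image fun ε => funComp e (f ε))
    (hg : g ∈ moderateTensor n X) :
    (fun ε => smoothSmul (f ε) (g ε)) ∈ negligibleTensor n X := fun e ij =>
  (hf e).mul_moderate (hg e ij)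

lemma smul_negligible_right (hf : f ∈ moderateFun n X) (hg : g ∈ negligibleTensor n X) :
    (fun ε => smoothSmul (f ε) (g ε)) ∈ negligibleTensor n X := fun e ij =>
  (hf e).mul_negligible (hg e ij)

end NetLemmas

lemma smoothFlat_sub (g : Tensor02 n X) (ξ ξ' : VecField n X) :
    smoothFlat g (ξ - ξ') = smoothFlat g ξ - smoothFlat g ξ' := by
  ext1 x
  exact map_sub (g x) _ _

lemma smoothPair_sub (θ : OneForm n X) (η η' : VecField n X) :
    smoothPair θ (η - η') = smoothPair θ η - smoothPair θ η' := by
  ext x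
  exact map_sub (θ x) _ _

lemma smoothSymProd_sub_left (φ φ' ψ : OneForm n X) :
    smoothSymProd (φ - φ') ψ = smoothSymProd φ ψ - smoothSymProd φ' ψ := by
  ext x v w
  change (1 / 2 : ℝ) * ((φ x v - φ' x v) * ψ x w + ψ x v * (φ x w - φ' x w)) =
    (1 / 2 : ℝ) * (φ x v * ψ x w + ψ x v * φ x w) - (1 / 2 : ℝ) * (φ' x v * ψ x w + ψ x v * φ' x w)
  ring

lemma smoothSymProd_sub_right (φ ψ ψ' : OneForm n X) :
    smoothSymProd φ (ψ - ψ') = smoothSymProd φ ψ - smoothSymProd φ ψ' := by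
  ext x v w
  change (1 / 2 : ℝ) * (φ x v * (ψ x w - ψ' x w) + (ψ x v - ψ' x v) * φ x w) =
    (1 / 2 : ℝ) * (φ x v * ψ x w + ψ x v * φ x w) - (1 / 2 : ℝ) * (φ x v * ψ' x w + ψ' x v * φ x w)
  ring

lemma smoothSmul_sub_left (f f' : SmoothFun n X) (g : Tensor02 n X) :
    smoothSmul (f - f') g = smoothSmul f g - smoothSmul f' g := by
  ext1 x
  exact sub_smul (f x) (f' x) (g x)

lemma smoothSmul_sub_right (f : SmoothFun n X) (g g' : Tensor02 n X) :
    smoothSmul f (g - g') = smoothSmul f g - smoothSmul f g' := by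
  ext1 x
  exact smul_sub (f x) (g x) (g' x)

/-- Descent of a binary operation to quotients. -/
def liftOp {R R' A B D : Type*} [Ring R] [Ring R'] [AddCommGroup A] [Module R A]
    [AddCommGroup B] [Module R' B] {p : Submodule R A} {q : Submodule R' B} (f : A → B → D)
    (h₁ : ∀ a a' b, a - a' ∈ p → f a b = f a' b) (h₂ : ∀ a b b', b - b' ∈ q → f a b = f a b') :
    A ⧸ p → B ⧸ q → D := fun x y =>
  Quotient.liftOn₂' x y f fun a b a' b' ha hb =>
    (h₁ a a' b ((Submodule.quotientRel_def p).1 ha)).trans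
      (h₂ a' b b' ((Submodule.quotientRel_def q).1 hb))

/-! #### Operations on generalized tensor fields, defined on representatives -/

/-- Lowering an index with `g`: `ξ_a = g_{ab} ξ^b`. -/
def flat : GenTensor02 n X → GenVecField n X → GenOneForm n X :=
  liftOp (fun g ξ => Submodule.Quotient.mk
      ⟨fun ε => smoothFlat (g.1 ε) (ξ.1 ε), flat_moderate g.2 ξ.2⟩)
    (fun g g' ξ h => (Submodule.Quotient.eq _).2 (flat_negligible_left h ξ.2))
    (fun g ξ ξ' h => (Submodule.Quotient.eq _).2 (by
      have := flat_negligible_right g.2 h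
      simp only [map_sub, Submodule.subtype_apply, Pi.sub_apply, smoothFlat_sub] at this
      exact this))

/-- The contraction `θ_a η^a`. -/
def pair : GenOneForm n X → GenVecField n X → GenFun n X :=
  liftOp (fun θ η => Ideal.Quotient.mk (negligibleFun n X)
      ⟨fun ε => smoothPair (θ.1 ε) (η.1 ε), pair_moderate θ.2 η.2⟩)
    (fun θ θ' η h => Ideal.Quotient.eq.2 (pair_negligible_left h η.2))
    (fun θ η η' h => Ideal.Quotient.eq.2 (by
      have := pair_negligible_right θ.2 h
      simp only [map_sub, Submodule.subtype_apply, Pi.sub_apply, smoothPair_sub] at this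
      exact this))

/-- The symmetrised product `φ_(a ψ_b) = (φ_a ψ_b + φ_b ψ_a) / 2`. -/
def symProd : GenOneForm n X → GenOneForm n X → GenTensor02 n X :=
  liftOp (fun φ ψ => Submodule.Quotient.mk
      ⟨fun ε => smoothSymProd (φ.1 ε) (ψ.1 ε), symProd_moderate φ.2 ψ.2⟩)
    (fun φ φ' ψ h => (Submodule.Quotient.eq _).2 (by
      have := symProd_negligible_left h ψ.2
      simp only [map_sub, Submodule.subtype_apply, Pi.sub_apply, smoothSymProd_sub_left] at this
      exact this))
    (fun φ ψ ψ' h => (Submodule.Quotient.eq _).2 (by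
      have := symProd_negligible_right φ.2 h
      simp only [map_sub, Submodule.subtype_apply, Pi.sub_apply, smoothSymProd_sub_right] at this
      exact this))

/-- The product of a generalized function and a generalized `(0, 2)`-tensor field. -/
def funSmul : GenFun n X → GenTensor02 n X → GenTensor02 n X :=
  liftOp (fun f g => Submodule.Quotient.mk
      ⟨fun ε => smoothSmul (f.1 ε) (g.1 ε), smul_moderate f.2 g.2⟩)
    (fun f f' g h => (Submodule.Quotient.eq _).2 (by
      have := smul_negligible_left (f := fun ε => f.1 ε - f'.1 ε) h g.2
      simp only [smoothSmul_sub_left] at this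
      exact this))
    (fun f g g' h => (Submodule.Quotient.eq _).2 (by
      have := smul_negligible_right f.2 h
      simp only [map_sub, Submodule.subtype_apply, Pi.sub_apply, smoothSmul_sub_right] at this
      exact this))

/-- The generalized function `⟨ξ, η⟩ = g(ξ, η) = g_{ab} ξ^a η^b`. -/
def genInner (g : GenTensor02 n X) (ξ η : GenVecField n X) : GenFun n X := pair (flat g ξ) η

/-- The component `g_{ij} ∈ 𝒢(ψ(V))` of a generalized `(0, 2)`-tensor field in a chart. -/
def coord (e : Chart n X) (i j : Fin n) : GenTensor02 n X → GenFunOn e.image := fun g =>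
  Quotient.liftOn' g (fun u => Ideal.Quotient.mk (negligibleNets e.image)
      ⟨fun ε => tensorComp e (i, j) (u.1 ε), u.2 e (i, j)⟩)
    fun u u' h => Ideal.Quotient.eq.2 (by
      have := (Submodule.quotientRel_def _).1 h e (i, j)
      simp only [map_sub, Submodule.subtype_apply, Pi.sub_apply] at this
      exact this)

/-! ### Positivity, generalized pseudo-Riemannian metrics, causality -/

/-- `f > 0` in `𝒢(X)`: `f` is invertible and for each compact `K ⊆ X` it has a representative
which is non-negative on `K`. -/
def StrictlyPositive (f : GenFun n X) : Prop :=
  IsUnit f ∧ ∀ K : Set X, IsCompact K → ∃ u : moderateFun n X,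
    Ideal.Quotient.mk (negligibleFun n X) u = f ∧ ∀ ε : Idx, ∀ x ∈ K, 0 ≤ u.1 ε x

/-- `f < 0` in `𝒢(X)`. -/
def StrictlyNegative (f : GenFun n X) : Prop := StrictlyPositive (-f)

/-- The restriction of the smooth tensor field `g` to `V` is a pseudo-Riemannian metric of
constant index `j`: pointwise it is symmetric, non-degenerate, and the maximal dimension of a
negative definite subspace is `j`. -/
def IsPseudoRiemannianOn (g : Tensor02 n X) (j : ℕ) (V : Set X) : Prop :=
  ∀ x ∈ V, (∀ v w : TangentSpace (𝓡 n) x, g x v w = g x w v) ∧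
    (∀ v : TangentSpace (𝓡 n) x, (∀ w : TangentSpace (𝓡 n) x, g x v w = 0) → v = 0) ∧
    sigNeg (LinearMap.BilinMap.toQuadraticMap (g x).toLinearMap₁₂) = j

/-- `g ∈ 𝒢⁰₂(X)` is a generalized pseudo-Riemannian metric of index `j`. -/
def IsGenMetricOfIndex (g : GenTensor02 n X) (j : ℕ) : Prop :=
  (∀ e : Chart n X, IsUnit (Matrix.of fun k l => coord e k l g).det) ∧
    ∀ V : Set X, IsOpen V → IsCompact (closure V) → ∃ u : moderateTensor n X,
      Submodule.Quotient.mk u = g ∧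
        ∃ ε₀ : ℝ, 0 < ε₀ ∧ ∀ ε : Idx, (ε : ℝ) < ε₀ → IsPseudoRiemannianOn (u.1 ε) j V

/-- Generalized Riemannian metrics: generalized pseudo-Riemannian metrics of index `0`. -/
def IsGenRiemannian (g : GenTensor02 n X) : Prop := IsGenMetricOfIndex g 0

/-- Generalized Lorentzian metrics: generalized pseudo-Riemannian metrics of index `1`. -/
def IsGenLorentzian (g : GenTensor02 n X) : Prop := IsGenMetricOfIndex g 1

/-- `ξ` is time-like with respect to `g`: `g(ξ, ξ) < 0` in `𝒢(X)`. -/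
def IsTimeLike (g : GenTensor02 n X) (ξ : GenVecField n X) : Prop :=
  StrictlyNegative (genInner g ξ ξ)

/-- Two (time-like) vector fields have the same time orientation: `g(ξ, η) < 0` in `𝒢(X)`. -/
def SameTimeOrientation (g : GenTensor02 n X) (ξ η : GenVecField n X) : Prop :=
  StrictlyNegative (genInner g ξ η)

end Generalized

end Colombeau

/-! Pointwise the claim is linear algebra. Let `B` be a Lorentzian scalar product, `x`, `y`
time-like with `B x y < 0`, and `h` the new form. For a vector `v` put `w = B x y • v - B x v • y`.
Then `w` is orthogonal to `x`, and `B w w = (B x v)² B y y - 2 B x y h(v, v)`. A Lorentzian form is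
positive definite on the complement of a time-like vector, so `B w w ≥ 0`, while `B y y < 0`; hence
`-2 B x y h(v, v) > 0` for `v ≠ 0`. This is `superEnergy_pos`.

Two points are not pointwise. Invertibility of the determinant in `𝒢(ψ(V))` requires a moderate
inverse, which non-degeneracy for each `ε` does not give. It follows from an identity over an
arbitrary commutative `ℝ`-algebra: up to the factor `-⟨ξ, η⟩ / 2` the matrix of `h` is a rank-two
perturbation of that of `g`, so its determinant is an explicit product of units
(`isUnit_det_superEnergy`). Further, strict negativity in `𝒢(X)` has to become negativity of actual
functions. An invertible generalized function with a representative non-negative on a compact set is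
bounded below there by a power of `ε`, which a negligible change cannot destroy, so every
representative is positive there for small `ε` (`StrictlyPositive.eventually_pos`). -/

namespace Colombeau

/-! ### Lorentzian scalar products -/

section LinearAlgebra

variable {V : Type*} [AddCommGroup V] [Module ℝ V] [FiniteDimensional ℝ V]

/-- A symmetric bilinear form of index one is non-negative on the orthogonal complement of a
time-like vector. -/
lemma nonneg_of_orthogonal_timelike {B : V →ₗ[ℝ] V →ₗ[ℝ] ℝ} (hs : ∀ v w, B v w = B w v)
    (hi : sigNeg (LinearMap.BilinMap.toQuadraticMap B) = 1) {x w : V} (hx : B x x < 0)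
    (hw : B x w = 0) : 0 ≤ B w w := by
  -- Otherwise `x` and `w` would span a negative definite plane, against index one.
  by_contra! hneg
  have hval : ∀ a b : ℝ, B (a • x + b • w) (a • x + b • w) = a ^ 2 * B x x + b ^ 2 * B w w := by
    intro a b
    simp only [map_add, map_smul, LinearMap.add_apply, LinearMap.smul_apply, smul_eq_mul, hs w x, hw]
    ring
  have hlin : LinearIndependent ℝ ![x, w] := by
    rw [LinearIndependent.pair_iff]
    intro a b hab
    have h := hval a b
    rw [hab, map_zero] at h
    have h1 : a ^ 2 * B x x ≤ 0 := mul_nonpos_of_nonneg_of_nonpos (sq_nonneg a) hx.le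
    have h2 : b ^ 2 * B w w ≤ 0 := mul_nonpos_of_nonneg_of_nonpos (sq_nonneg b) hneg.le
    have h3 : a ^ 2 * B x x = 0 := by linarith
    have h4 : b ^ 2 * B w w = 0 := by linarith
    simpa [hx.ne, hneg.ne] using And.intro h3 h4
  have hdef : ((-(LinearMap.BilinMap.toQuadraticMap B)).restrict
      (Submodule.span ℝ (Set.range ![x, w]))).PosDef := by
    rintro ⟨v, hv⟩ hv0
    have hv0' : v ≠ 0 := fun h => hv0 (Subtype.ext h)
    have hv' := hv
    rw [Matrix.range_cons, Matrix.range_cons, Matrix.range_empty, Set.union_empty,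
      Set.singleton_union, Submodule.mem_span_pair] at hv'
    obtain ⟨a, b, rfl⟩ := hv'
    change 0 < -(B (a • x + b • w) (a • x + b • w))
    rw [hval]
    by_cases ha : a = 0
    · have hb : b ≠ 0 := by
        rintro rfl
        simp [ha] at hv0'
      have := mul_neg_of_pos_of_neg (sq_pos_of_ne_zero hb) hneg
      simp only [ha]
      linarith
    · have h1 := mul_neg_of_pos_of_neg (sq_pos_of_ne_zero ha) hx
      have h2 : b ^ 2 * B w w ≤ 0 := mul_nonpos_of_nonneg_of_nonpos (sq_nonneg b) hneg.le
      linarith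
  have h := le_sigNeg_of_negDef _ hdef
  rw [finrank_span_eq_card hlin, hi] at h
  simp at h

/-- A Lorentzian scalar product is positive definite on the orthogonal complement of a time-like
vector. -/
lemma pos_of_orthogonal_timelike {B : V →ₗ[ℝ] V →ₗ[ℝ] ℝ} (hs : ∀ v w, B v w = B w v)
    (hnd : ∀ v, (∀ w, B v w = 0) → v = 0)
    (hi : sigNeg (LinearMap.BilinMap.toQuadraticMap B) = 1) {x w : V} (hx : B x x < 0)
    (hw : B x w = 0) (hw0 : w ≠ 0) : 0 < B w w := by
  refine (nonneg_of_orthogonal_timelike hs hi hx hw).lt_of_ne' fun hww => hw0 (hnd w fun z => ?_)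
  by_contra hz
  -- A null `w` in the complement of `x` lies in the radical. It suffices to pair it with the
  -- projection `z'` of `z` to that complement, where `B` is semidefinite; there the linear term in
  -- `τ` below must vanish.
  set z' : V := z - (B x z / B x x) • x with hz'
  have hxz' : B x z' = 0 := by
    simp only [hz', map_sub, map_smul, smul_eq_mul]
    field_simp [hx.ne]
    ring
  have hwz' : B w z' = B w z := by
    simp [hz', hs w x, hw]
  have key : ∀ τ : ℝ, 0 ≤ 2 * τ * B w z + τ ^ 2 * B z' z' := by
    intro τ
    have h := nonneg_of_orthogonal_timelike hs hi hx (w := w + τ • z') (by simp [hw, hxz'])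
    simp only [map_add, map_smul, LinearMap.add_apply, LinearMap.smul_apply, smul_eq_mul, hww,
      hs z' w, hwz'] at h
    linarith
  have hzz := nonneg_of_orthogonal_timelike hs hi hx hxz'
  -- The added `1` keeps the denominator positive when `B z' z' = 0`.
  have h := key (-(B w z) / (B z' z' + 1))
  have h1 : 0 < B z' z' + 1 := by linarith
  have h2 : 2 * (-(B w z) / (B z' z' + 1)) * B w z
      + (-(B w z) / (B z' z' + 1)) ^ 2 * B z' z'
      = -((B w z) ^ 2 * (B z' z' + 2)) / (B z' z' + 1) ^ 2 := by
    field_simp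
    ring
  rw [h2] at h
  have h3 : 0 < (B w z) ^ 2 * (B z' z' + 2) := by positivity
  have h4 : -((B w z) ^ 2 * (B z' z' + 2)) / (B z' z' + 1) ^ 2 < 0 :=
    div_neg_of_neg_of_pos (by linarith) (by positivity)
  linarith

/-- The form `x_(a y_b) - ⟨x, y⟩ B_{ab} / 2` is positive definite if `x` and `y` are time-like with
the same time orientation. -/
lemma superEnergy_pos {B : V →ₗ[ℝ] V →ₗ[ℝ] ℝ} (hs : ∀ v w, B v w = B w v)
    (hnd : ∀ v, (∀ w, B v w = 0) → v = 0)
    (hi : sigNeg (LinearMap.BilinMap.toQuadraticMap B) = 1) {x y : V} (hx : B x x < 0)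
    (hy : B y y < 0) (hxy : B x y < 0) {v : V} (hv : v ≠ 0) :
    0 < B x v * B y v - 1 / 2 * B x y * B v v := by
  set w : V := B x y • v - B x v • y with hw
  have hxw : B x w = 0 := by
    simp only [hw, map_sub, map_smul, smul_eq_mul]
    ring
  have hww : B w w = (B x v) ^ 2 * B y y
      - 2 * B x y * (B x v * B y v - 1 / 2 * B x y * B v v) := by
    simp only [hw, map_sub, map_smul, LinearMap.sub_apply, LinearMap.smul_apply, smul_eq_mul,
      hs v y]
    ring
  have hpos : 0 < B w w - (B x v) ^ 2 * B y y := by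
    -- Both summands are non-negative. If `B x v = 0`, then `w` is a nonzero multiple of `v` and the
    -- first is strict; otherwise the second is.
    by_cases h : B x v = 0
    · have hw0 : w ≠ 0 := by
        rw [hw, h, zero_smul, sub_zero]
        exact smul_ne_zero hxy.ne hv
      simpa [h] using pos_of_orthogonal_timelike hs hnd hi hx hxw hw0
    · have h1 := mul_neg_of_pos_of_neg (sq_pos_of_ne_zero h) hy
      have h2 := nonneg_of_orthogonal_timelike hs hi hx hxw
      linarith
  by_contra! hle
  have := mul_nonneg_of_nonpos_of_nonpos hxy.le hle
  linarith

/-- A positive definite form has index zero. -/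
lemma sigNeg_eq_zero_of_pos {B : V →ₗ[ℝ] V →ₗ[ℝ] ℝ} (h : ∀ v, v ≠ 0 → 0 < B v v) :
    sigNeg (LinearMap.BilinMap.toQuadraticMap B) = 0 := by
  obtain ⟨W, hW, hdef⟩ :=
    exists_finrank_eq_sigNeg_and_negDef (LinearMap.BilinMap.toQuadraticMap B)
  rw [← hW, Submodule.finrank_eq_zero, Submodule.eq_bot_iff]
  intro v hv
  by_contra hv0
  have h1 : 0 < -(B v v) := hdef ⟨v, hv⟩ fun h => hv0 (congrArg Subtype.val h)
  linarith [h v hv0]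

end LinearAlgebra

/-! ### The determinant over a commutative ring -/

/-- The matrix of `x_(a y_b) - ⟨x, y⟩ G_{ab} / 2` has determinant
`-c^(n-2) ⟨x, x⟩ ⟨y, y⟩ det G / 4` with `c = -⟨x, y⟩ / 2`. In particular it is invertible if
`det G` and the three scalar products are. -/
lemma isUnit_det_superEnergy {R : Type*} [CommRing R] [Algebra ℝ R] {n : ℕ}
    {G H : Matrix (Fin n) (Fin n) R} {x y a b : Fin n → R} {s : R}
    (ha : ∀ j, a j = ∑ i, x i * G i j) (hb : ∀ j, b j = ∑ i, y i * G i j)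
    (hs : s = ∑ j, y j * a j)
    (hH : ∀ i j, H i j = (1 / 2 : ℝ) • (a i * b j + b i * a j) - (1 / 2 : ℝ) • (s * G i j))
    (hG : IsUnit G.det) (hsu : IsUnit s) (hx : IsUnit (∑ j, x j * a j))
    (hy : IsUnit (∑ j, y j * b j)) : IsUnit H.det := by
  set h : R := algebraMap ℝ R (1 / 2) with hh
  have hu : IsUnit h := (IsUnit.mk0 (1 / 2 : ℝ) (by norm_num)).map (algebraMap ℝ R)
  have h2 : h + h = 1 := by rw [hh, ← map_add]; norm_num
  have hcu : IsUnit (-(h * s)) := (hu.mul hsu).neg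
  -- Working with `d = c⁻¹` and the product `c ^ n * d ^ 2` avoids the exponent `n - 2`, so small
  -- `n` needs no separate case.
  obtain ⟨d, hd⟩ := hcu.exists_right_inv
  have hdu : IsUnit d := IsUnit.of_mul_eq_one_right _ hd
  let A : Matrix (Fin n) (Fin 2) R := Matrix.of fun i k => ![h * a i, h * b i] k
  let B : Matrix (Fin 2) (Fin n) R := Matrix.of fun k j => ![d * y j, d * x j] k
  have hfac : H = -(h * s) • ((1 + A * B) * G) := by
    ext i j
    have hAB : (A * B * G) i j = d * (h * a i * b j + h * b i * a j) := by
      rw [Matrix.mul_assoc, Matrix.mul_apply, Fin.sum_univ_two, Matrix.mul_apply, Matrix.mul_apply,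
        ha j, hb j]
      simp only [A, B, Matrix.of_apply, Matrix.cons_val_zero, Matrix.cons_val_one, mul_assoc,
        ← Finset.mul_sum]
      ring
    rw [hH, Matrix.smul_apply, Matrix.add_mul, Matrix.one_mul, Matrix.add_apply, hAB,
      Algebra.smul_def, Algebra.smul_def, ← hh, smul_eq_mul]
    linear_combination -(h * a i * b j + h * b i * a j) * hd
  -- Since `det (1 + A * B) = det (1 + B * A)`, a `2 × 2` determinant suffices. Its first diagonal
  -- entry `1 + d * h * s` is zero by `hd`, so only the product of the off-diagonal entries
  -- survives.
  have hdet : (1 + B * A).det = -(d * h) ^ 2 * (∑ j, x j * a j) * (∑ j, y j * b j) := by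
    have e : ∀ (p q : Fin n → R), ∑ j, d * p j * (h * q j) = d * h * ∑ j, p j * q j := by
      intro p q
      rw [Finset.mul_sum]
      exact Finset.sum_congr rfl fun j _ => by ring
    rw [Matrix.det_fin_two]
    simp only [Matrix.add_apply, Matrix.mul_apply, A, B, Matrix.of_apply, Matrix.cons_val_zero,
      Matrix.cons_val_one, e, ← hs, Matrix.one_apply_eq]
    rw [Matrix.one_apply_ne (by decide), Matrix.one_apply_ne (by decide)]
    linear_combination (-(1 + d * h * ∑ j, x j * b j)) * hd
  rw [hfac, Matrix.det_smul, Matrix.det_mul, Matrix.det_one_add_mul_comm, hdet, neg_mul, neg_mul]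
  exact (hcu.pow _).mul ((((((hdu.mul hu).pow 2).mul hx).mul hy).neg).mul hG)

/-! ### Local expressions of generalized functions and tensor fields -/

section Restriction

variable {n : ℕ} {X : Type*} [TopologicalSpace X] [ChartedSpace (Euc n) X]

/-- The class in `𝒢(ψ(V))` of a moderate net. -/
noncomputable def toGen (e : Chart n X) (u : Idx → Euc n → ℝ) (hu : IsModerate e.image u) :
    GenFunOn e.image :=
  Ideal.Quotient.mk (negligibleNets e.image) ⟨u, hu⟩

lemma sum_mk_mul_mk {S ι : Type*} [CommRing S] (J : Ideal S) [Fintype ι] (a b : ι → S) :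
    ∑ i, Ideal.Quotient.mk J (a i) * Ideal.Quotient.mk J (b i) =
      Ideal.Quotient.mk J (∑ i, a i * b i) := by
  rw [map_sum]
  simp_rw [map_mul]

lemma toGen_sum (e : Chart n X) {ι : Type*} [Fintype ι] (u v : ι → Idx → Euc n → ℝ)
    (hu : ∀ i, IsModerate e.image (u i)) (hv : ∀ i, IsModerate e.image (v i))
    {w : Idx → Euc n → ℝ} (hw : IsModerate e.image w)
    (h : ∀ ε, EqOn (w ε) (∑ i, u i ε * v i ε) e.image) :
    toGen e w hw = ∑ i, toGen e (u i) (hu i) * toGen e (v i) (hv i) := by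
  refine Eq.trans ?_ (sum_mk_mul_mk (negligibleNets e.image)
    (fun i => ⟨u i, hu i⟩) fun i => ⟨v i, hv i⟩).symm
  -- The nets are functions on all of `ℝⁿ` and are known to agree only on the chart image, so
  -- equality is available in the quotient and not for the nets themselves.
  refine Ideal.Quotient.eq.2 ((isNegligible_zero (Ω := e.image)).congr fun ε y hy => ?_)
  have hwy := h ε hy
  change w ε y - ((∑ i, (⟨u i, hu i⟩ * ⟨v i, hv i⟩ : moderateNets e.image) :
    moderateNets e.image) : Idx → Euc n → ℝ) ε y = 0
  rw [hwy]
  simp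

lemma StrictlyNegative.isUnit {f : GenFun n X} (h : StrictlyNegative f) : IsUnit f :=
  (IsUnit.neg_iff f).1 h.1

variable [IsManifold (𝓡 n) ∞ X]

/-- The local expression in a chart, as a homomorphism of algebras of moderate nets. -/
noncomputable def moderateRestrict (e : Chart n X) :
    moderateFun n X →+* moderateNets e.image where
  toFun u := ⟨fun ε => funComp e (u.1 ε), u.2 e⟩
  map_one' := rfl
  map_mul' _ _ := rfl
  map_zero' := rfl
  map_add' _ _ := rfl

/-- The local expression of a generalized function in a chart. -/
noncomputable def genRestrict (e : Chart n X) : GenFun n X →+* GenFunOn e.image :=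
  Ideal.quotientMap _ (moderateRestrict e) fun _ hu => hu e

/-- The representative of `ξ_(a η_b) - ⟨ξ, η⟩ g_{ab} / 2` determined by representatives. -/
noncomputable def superEnergy (g : Tensor02 n X) (ξ η : VecField n X) : Tensor02 n X :=
  smoothSymProd (smoothFlat g ξ) (smoothFlat g η)
    - (1 / 2 : ℝ) • smoothSmul (smoothPair (smoothFlat g ξ) η) g

lemma superEnergy_apply (g : Tensor02 n X) (ξ η : VecField n X) (x : X)
    (v w : TangentSpace (𝓡 n) x) : superEnergy g ξ η x v w =
      1 / 2 * (g x (ξ x) v * g x (η x) w + g x (η x) v * g x (ξ x) w)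
        - 1 / 2 * (g x (ξ x) (η x) * g x v w) := rfl

lemma superEnergy_moderate (g : moderateTensor n X) (ξ η : moderateVec n X) :
    (fun ε => superEnergy (g.1 ε) (ξ.1 ε) (η.1 ε)) ∈ moderateTensor n X :=
  (moderateTensor n X).sub_mem
    (symProd_moderate (flat_moderate g.2 ξ.2) (flat_moderate g.2 η.2))
    ((moderateTensor n X).smul_mem (1 / 2 : ℝ)
      (smul_moderate (pair_moderate (flat_moderate g.2 ξ.2) η.2) g.2))

/-- Every tensor operation is defined on representatives, so both sides unfold to the same class. -/
lemma mk_superEnergy (g : moderateTensor n X) (ξ η : moderateVec n X) :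
    (Submodule.Quotient.mk ⟨_, superEnergy_moderate g ξ η⟩ : GenTensor02 n X) =
      symProd (flat (Submodule.Quotient.mk g) (Submodule.Quotient.mk ξ))
          (flat (Submodule.Quotient.mk g) (Submodule.Quotient.mk η))
        - (1 / 2 : ℝ) • funSmul
          (genInner (Submodule.Quotient.mk g) (Submodule.Quotient.mk ξ) (Submodule.Quotient.mk η))
          (Submodule.Quotient.mk g) := rfl

/-- In a chart, lowering an index and contracting become matrix formulas over `𝒢(ψ(V))`, and the
ring homomorphism `genRestrict e` keeps the scalar products invertible. The algebraic determinant
lemma then applies. -/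
lemma isUnit_det_coord_superEnergy (e : Chart n X) (g : moderateTensor n X) (ξ η : moderateVec n X)
    (hg : IsUnit (Matrix.of fun k l => coord e k l (Submodule.Quotient.mk g)).det)
    (hξ : IsUnit (genInner (Submodule.Quotient.mk g) (Submodule.Quotient.mk ξ)
      (Submodule.Quotient.mk ξ)))
    (hη : IsUnit (genInner (Submodule.Quotient.mk g) (Submodule.Quotient.mk η)
      (Submodule.Quotient.mk η)))
    (hξη : IsUnit (genInner (Submodule.Quotient.mk g) (Submodule.Quotient.mk ξ)
      (Submodule.Quotient.mk η))) :
    IsUnit (Matrix.of fun k l =>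
      coord e k l (Submodule.Quotient.mk ⟨_, superEnergy_moderate g ξ η⟩)).det := by
  have hflat : ∀ (ζ : moderateVec n X) (j : Fin n),
      toGen e (fun ε => formComp e j (smoothFlat (g.1 ε) (ζ.1 ε))) (flat_moderate g.2 ζ.2 e j) =
      ∑ i, toGen e (fun ε => vecComp e i (ζ.1 ε)) (ζ.2 e i) *
        toGen e (fun ε => tensorComp e (i, j) (g.1 ε)) (g.2 e (i, j)) := fun ζ j =>
    toGen_sum e _ _ _ _ _ fun ε => formComp_flat e j (g.1 ε) (ζ.1 ε)
  have hpair : ∀ ζ χ : moderateVec n X,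
      genRestrict e (genInner (Submodule.Quotient.mk g) (Submodule.Quotient.mk ζ)
        (Submodule.Quotient.mk χ)) =
      ∑ j, toGen e (fun ε => vecComp e j (χ.1 ε)) (χ.2 e j) *
        toGen e (fun ε => formComp e j (smoothFlat (g.1 ε) (ζ.1 ε)))
          (flat_moderate g.2 ζ.2 e j) := fun ζ χ =>
    toGen_sum e _ _ _ _ (pair_moderate (flat_moderate g.2 ζ.2) χ.2 e)
      fun ε => funComp_pair e (smoothFlat (g.1 ε) (ζ.1 ε)) (χ.1 ε)
  refine isUnit_det_superEnergy (hflat ξ) (hflat η) (hpair ξ η) (fun i j => ?_) hg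
    (hξη.map (genRestrict e)) ?_ ?_
  · rfl
  · rw [← hpair]; exact hξ.map (genRestrict e)
  · rw [← hpair]; exact hη.map (genRestrict e)

end Restriction

/-! ### Strict positivity and representatives -/

section Positivity

variable {n : ℕ} {X : Type*} [TopologicalSpace X] [ChartedSpace (Euc n) X]
  [IsManifold (𝓡 n) ∞ X]

lemma IsModerate.exists_bound {Ω : TopologicalSpace.Opens (Euc n)} {u : Idx → Euc n → ℝ}
    (hu : IsModerate Ω u) {K : Set (Euc n)} (hK : K ⊆ Ω) (hc : IsCompact K) :
    ∃ (N : ℕ) (C : ℝ), 0 < C ∧ ∀ᶠ ε in toZero, ∀ x ∈ K, |u ε x| * (ε : ℝ) ^ N ≤ C := by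
  obtain ⟨N, C, hC⟩ := hu.2 K hK hc 0
  refine ⟨N, |C| + 1, by positivity, hC.mono fun ε hε x hx => ?_⟩
  have h := hε x hx
  have h0 : (0 : ℝ) < (ε : ℝ) ^ N := pow_pos ε.2.1 N
  rw [norm_iteratedFDerivWithin_zero, Real.norm_eq_abs, zpow_neg, zpow_natCast,
    ← div_eq_mul_inv, le_div_iff₀ h0] at h
  linarith [le_abs_self C]

lemma IsNegligible.exists_bound {Ω : TopologicalSpace.Opens (Euc n)} {u : Idx → Euc n → ℝ}
    (hu : IsNegligible Ω u) {K : Set (Euc n)} (hK : K ⊆ Ω) (hc : IsCompact K) (m : ℕ) :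
    ∃ C : ℝ, 0 < C ∧ ∀ᶠ ε in toZero, ∀ x ∈ K, |u ε x| ≤ C * (ε : ℝ) ^ m := by
  obtain ⟨C, hC⟩ := hu.2 K hK hc 0 m
  refine ⟨|C| + 1, by positivity, hC.mono fun ε hε x hx => ?_⟩
  have h := hε x hx
  have h0 : (0 : ℝ) < (ε : ℝ) ^ m := pow_pos ε.2.1 m
  rw [norm_iteratedFDerivWithin_zero, Real.norm_eq_abs, zpow_natCast] at h
  nlinarith [le_abs_self C]

lemma eventually_toZero_lt {δ : ℝ} (hδ : 0 < δ) : ∀ᶠ ε : Idx in toZero, (ε : ℝ) < δ :=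
  (eventually_lt_nhds hδ).comap _

/-- A net which is non-negative on `K` up to a negligible net, and invertible up to a negligible
net, is eventually positive on `K`. -/
lemma eventually_pos_of_nonneg_of_inv {Ω : TopologicalSpace.Opens (Euc n)}
    {u v w : Idx → Euc n → ℝ} (hv : IsModerate Ω v) (huw : IsNegligible Ω (w - u))
    (hwv : IsNegligible Ω (w * v - 1)) {K : Set (Euc n)} (hK : K ⊆ Ω) (hc : IsCompact K) :
    ∀ᶠ ε in toZero, ∀ x ∈ K, 0 ≤ w ε x → 0 < u ε x := by
  obtain ⟨N, C, hC, h1⟩ := hv.exists_bound hK hc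
  obtain ⟨C₁, hC₁, h2⟩ := hwv.exists_bound hK hc 1
  -- The inverse `v` is `O(ε ^ (-N))`, which forces `w > ε ^ N / (2 * C)` where `w ≥ 0`. One order
  -- more in the bound on `w - u` makes it smaller than this once `ε < 1 / (2 * C * C₂)`; the
  -- condition `ε < 1 / (2 * C₁)` gives `|w v - 1| < 1 / 2`.
  obtain ⟨C₂, hC₂, h3⟩ := huw.exists_bound hK hc (N + 1)
  have h4 : 0 < 1 / (2 * C₁) := by positivity
  have h5 : 0 < 1 / (2 * C * C₂) := by positivity
  filter_upwards [h1, h2, h3, eventually_toZero_lt h4, eventually_toZero_lt h5]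
    with ε h1 h2 h3 h4 h5 x hx hw
  have h0 : (0 : ℝ) < (ε : ℝ) ^ N := pow_pos ε.2.1 N
  have hε : (0 : ℝ) < ε := ε.2.1
  have h1 := h1 x hx
  have h2 : |w ε x * v ε x - 1| ≤ C₁ * (ε : ℝ) ^ 1 := h2 x hx
  have h3 : |w ε x - u ε x| ≤ C₂ * (ε : ℝ) ^ (N + 1) := h3 x hx
  rw [lt_div_iff₀ (by positivity)] at h4 h5
  have h6 : 1 / 2 < w ε x * |v ε x| := by
    have ha := (abs_le.1 h2).1
    have hb := mul_le_mul_of_nonneg_left (le_abs_self (v ε x)) hw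
    rw [pow_one] at ha
    linarith
  have h7 : (ε : ℝ) ^ N < 2 * C * w ε x := by
    have ha := mul_lt_mul_of_pos_right h6 h0
    have hb := mul_le_mul_of_nonneg_left h1 hw
    linarith
  have h8 : w ε x - u ε x ≤ C₂ * (ε : ℝ) ^ (N + 1) := (abs_le.1 h3).2
  have h9 : 2 * C * (C₂ * (ε : ℝ) ^ (N + 1)) < (ε : ℝ) ^ N := by
    have := mul_lt_mul_of_pos_left h5 h0
    rw [pow_succ]
    linarith
  have h10 : 2 * C * (w ε x - u ε x) ≤ 2 * C * (C₂ * (ε : ℝ) ^ (N + 1)) := by gcongr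
  have h11 : 0 < 2 * C * u ε x := by linarith
  exact pos_of_mul_pos_right h11 (by positivity)

/-- Every representative of a strictly positive generalized function is eventually positive on
each compact set. -/
lemma StrictlyPositive.eventually_pos {u : moderateFun n X}
    (hu : StrictlyPositive (Ideal.Quotient.mk (negligibleFun n X) u)) {K : Set X}
    (hK : IsCompact K) : ∀ᶠ ε in toZero, ∀ x ∈ K, 0 < u.1 ε x := by
  obtain ⟨hunit, hrep⟩ := hu
  obtain ⟨w, hw, hpos⟩ := hrep K hK
  obtain ⟨v', hv'⟩ := hunit.exists_right_inv
  obtain ⟨v, rfl⟩ := Ideal.Quotient.mk_surjective v'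
  rw [← hw, ← map_mul, ← map_one (Ideal.Quotient.mk (negligibleFun n X)), Ideal.Quotient.eq] at hv'
  have hwu := Ideal.Quotient.eq.1 hw
  -- The chart neighbourhoods used for the compactness induction may leave `K`, where `w` can be
  -- negative; therefore `0 ≤ w` becomes a premise of the local claim.
  suffices h : ∀ᶠ ε in toZero, ∀ x ∈ K, 0 ≤ w.1 ε x → 0 < u.1 ε x from
    h.mono fun ε h x hx => h x hx (hpos ε x hx)
  refine hK.induction_on (p := fun s => ∀ᶠ ε in toZero, ∀ x ∈ s, 0 ≤ w.1 ε x → 0 < u.1 ε x)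
    (by simp) (fun s t hst ht => ht.mono fun ε h x hx => h x (hst hx))
    (fun s t hs ht => ?_) fun x _ => ?_
  · filter_upwards [hs, ht] with ε h1 h2 x hx using hx.elim (h1 x) (h2 x)
  · let e : Chart n X := ⟨chartAt (Euc n) x, IsManifold.chart_mem_maximalAtlas x⟩
    have hxs : x ∈ e.1.source := mem_chart_source (Euc n) x
    obtain ⟨L, hL, hLt, hLc⟩ := exists_compact_subset e.1.open_target (e.1.map_source hxs)
    refine ⟨e.1.source ∩ e.1 ⁻¹' L, mem_nhdsWithin_of_mem_nhds (inter_mem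
      (e.1.open_source.mem_nhds hxs) ((e.1.continuousAt hxs).preimage_mem_nhds
        (mem_interior_iff_mem_nhds.1 hLt))), ?_⟩
    have := eventually_pos_of_nonneg_of_inv (v.2 e) (hwu e) (hv' e) hLc hL
    refine this.mono fun ε h y hy => ?_
    have h' : 0 ≤ w.1 ε (e.1.symm (e.1 y)) → 0 < u.1 ε (e.1.symm (e.1 y)) := h (e.1 y) hy.2
    rwa [e.1.left_inv hy.1] at h'

lemma StrictlyNegative.eventually_neg {u : moderateFun n X}
    (hu : StrictlyNegative (Ideal.Quotient.mk (negligibleFun n X) u)) {K : Set X}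
    (hK : IsCompact K) : ∀ᶠ ε in toZero, ∀ x ∈ K, u.1 ε x < 0 := by
  have h : StrictlyPositive (Ideal.Quotient.mk (negligibleFun n X) (-u)) := by
    rw [RingHom.map_neg]; exact hu
  exact (h.eventually_pos hK).mono fun ε h x hx => neg_pos.1 (h x hx)

end Positivity

/-! ### Passage from the pointwise statement to the theorem -/

/-- Pointwise, `ξ_(a η_b) - ⟨ξ, η⟩ g_{ab} / 2` is a Riemannian metric. -/
lemma isPseudoRiemannianOn_superEnergy {n : ℕ} {X : Type*} [TopologicalSpace X]
    [ChartedSpace (Euc n) X] [IsManifold (𝓡 n) ∞ X] {g : Tensor02 n X} {ξ η : VecField n X}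
    {V : Set X} (hg : IsPseudoRiemannianOn g 1 V) (hξ : ∀ x ∈ V, g x (ξ x) (ξ x) < 0)
    (hη : ∀ x ∈ V, g x (η x) (η x) < 0) (hξη : ∀ x ∈ V, g x (ξ x) (η x) < 0) :
    IsPseudoRiemannianOn (superEnergy g ξ η) 0 V := by
  intro x hx
  obtain ⟨hs, hnd, hi⟩ := hg x hx
  have : FiniteDimensional ℝ (TangentSpace (𝓡 n) x) :=
    inferInstanceAs (FiniteDimensional ℝ (Euc n))
  have hpos : ∀ v : TangentSpace (𝓡 n) x, v ≠ 0 → 0 < superEnergy g ξ η x v v := by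
    intro v hv
    have h : 0 < g x (ξ x) v * g x (η x) v - 1 / 2 * g x (ξ x) (η x) * g x v v :=
      superEnergy_pos (B := (g x).toLinearMap₁₂) hs hnd hi (hξ x hx) (hη x hx)
      (hξη x hx) hv
    rw [superEnergy_apply]
    linarith
  refine ⟨fun v w => ?_, fun v hv => ?_, ?_⟩
  · rw [superEnergy_apply, superEnergy_apply, hs v w]
    ring
  · by_contra hv0
    exact (hpos v hv0).ne' (hv v)
  · exact sigNeg_eq_zero_of_pos hpos

end Colombeau

theorem mainTheorem10 (n : ℕ) (X : Type*) [TopologicalSpace X] [T2Space X] [ParacompactSpace X]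
    [ChartedSpace (Colombeau.Euc n) X] [IsManifold (𝓡 n) ∞ X]
    (g : Colombeau.GenTensor02 n X) (ξ η : Colombeau.GenVecField n X)
    (hg : Colombeau.IsGenLorentzian g)
    (hξ : Colombeau.IsTimeLike g ξ) (hη : Colombeau.IsTimeLike g η)
    (hξη : Colombeau.SameTimeOrientation g ξ η) :
    Colombeau.IsGenRiemannian
      (Colombeau.symProd (Colombeau.flat g ξ) (Colombeau.flat g η)
        - (1 / 2 : ℝ) • Colombeau.funSmul (Colombeau.genInner g ξ η) g) := by
  obtain ⟨ξ, rfl⟩ := Submodule.Quotient.mk_surjective _ ξ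
  obtain ⟨η, rfl⟩ := Submodule.Quotient.mk_surjective _ η
  refine ⟨fun e => ?_, fun V hV hVc => ?_⟩
  · obtain ⟨g, rfl⟩ := Submodule.Quotient.mk_surjective _ g
    exact Colombeau.isUnit_det_coord_superEnergy e g ξ η (hg.1 e) hξ.isUnit hη.isUnit hξη.isUnit
  -- The representative of `g` depends on `V`. The representatives of `ξ` and `η` can be arbitrary,
  -- since a strictly negative scalar product is eventually negative on the compact closure of `V`
  -- in every representative.
  · obtain ⟨u, rfl, ε₀, hε₀, hu⟩ := hg.2 V hV hVc
    refine ⟨⟨_, Colombeau.superEnergy_moderate u ξ η⟩, Colombeau.mk_superEnergy u ξ η, ?_⟩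
    have h1 := Colombeau.StrictlyNegative.eventually_neg hξ hVc
    have h2 := Colombeau.StrictlyNegative.eventually_neg hη hVc
    have h3 := Colombeau.StrictlyNegative.eventually_neg hξη hVc
    -- As `toZero` is a comap of `𝓝 0`, an eventual property holds for all indices in some ball
    -- around `0`; its radius supplies the threshold `δ`.
    obtain ⟨t, ht, hsub⟩ := ((h1.and h2).and h3)
    obtain ⟨δ, hδ, hball⟩ := Metric.mem_nhds_iff.1 ht
    refine ⟨min ε₀ δ, lt_min hε₀ hδ, fun ε hε => ?_⟩
    obtain ⟨⟨k1, k2⟩, k3⟩ := hsub (a := ε) (hball (by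
      rw [Metric.mem_ball, Real.dist_eq, sub_zero, abs_of_pos ε.2.1]
      exact hε.trans_le (min_le_right _ _)))
    exact Colombeau.isPseudoRiemannianOn_superEnergy (hu ε (hε.trans_le (min_le_left _ _)))
      (fun x hx => k1 x (subset_closure hx)) (fun x hx => k2 x (subset_closure hx))
      (fun x hx => k3 x (subset_closure hx))
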